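/- Let $\mathbb F_q$ be a finite field, let $m=n\ge 1$, let $E=\mathbb F_q^n$, and let $\Sigma(E)$ be the set of linear subspaces of $E$. For $X\in\Sigma(E)$ let $X^\perp$ be its orthogonal complement with respect to the standard dot product. A $(q,m)$-demi-polymatroid is a pair $P=(E,\rho)$ with $\rho:\Sigma(E)\to\mathbb N_0$ such that (R1) $0\le\rho(X)\le m\dim X$ for all $X$; (R2) $\rho(X)\le\rho(Y)$ whenever $X\subseteq Y$; and the function $\rho^*(X)=\rho(X^\perp)+m\dim X-\rho(E)$ is nonnegative and also satisfies (R1) and (R2). The conullity function is $\nu^*(X)=m\dim X-\rho^*(X)=\rho(E)-\rho(X^\perp)$, and for $1\le r\le\rho(E)$ the $r$th generalized weight is $d_r(P)=\min\{\dim X: X\in\Sigma(E),\ \nu^*(X)\ge r\}$. Let $C$ be a Delsarte code, that is, a linear subspace of the space $\mathbb M$ of $m\times n$ matrices over $\mathbb F_q$, and let $K=\dim C$. Let $C^T=\{M^t: M\in C\}$ and $C^\perp=\{N\in\mathbb M:\operatorname{Trace}(MN^t)=0\text{ for all }M\in C\}$. For a Delsarte code $D$ and $X\in\Sigma(E)$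 let $D(X)$ be the subspace of all matrices in $D$ whose row space is contained in $X$; put $\rho_D(X)=\dim D-\dim D(X^\perp)$ and $P(D)=(E,\rho_D)$, with conullity function and generalized weights defined by the same formulas. An optimal anticode is a linear subspace $\mathcal A\subseteq\mathbb M$ whose dimension is $m$ times the maximum rank of a matrix in $\mathcal A$. For $1\le r\le\dim D$ put $$a_r(D)=\frac1m\min\{\dim\mathcal A:\mathcal A\text{ an optimal anticode with }\dim(\mathcal A\cap D)\ge r\}.$$ Define $\rho(X)=\min\{\rho_C(X),\rho_{C^T}(X)\}$ for $X\in\Sigma(E)$. Then: 1. $P=(E,\rho)$ is a $(q,m)$-demi-polymatroid, and its conullity function is $\nu^*(X)=\max\{\dim C(X),\dim C^T(X)\}$. 2. $d_r(P)=\min\{d_r(P(C)),d_r(P(C^T))\}$ for $r=1,\dots,\rho(E)$. 3. Wei duality holds for the weights $a_r$ of $C$ and $C^\perp$, in the following sense. (a) If $p,i,j$ are integers with $1\le p+im\le mn-K$ and $1\le p+K+jm\le K$, then $a_{p+im}(C^\perp)\ne n+1-a_{p+K+jm}(C)$. (b) For every integer $s$ with $0\le s<m$, $$\{a_r(C^\perp):1\le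 r\le mn-K,\ r\equiv s\ (\mathrm{mod}\ m)\}=\{1,\dots,n\}\setminus\{n+1-a_r(C):1\le r\le K,\ r\equiv s+K\ (\mathrm{mod}\ m)\}.$$ -/

import Mathlib

open Module

namespace RankMetric

variable {F : Type*} [Field F] {m n : ℕ}

/-! ### Demi-polymatroids on `E = F ^ n`

Functions on the set `Σ(E)` of subspaces of `E` are taken with values in `ℤ`, so that no subtraction
is truncated; condition (R1) includes nonnegativity. -/

/-- The orthogonal complement of `X` in `F ^ n` for the standard dot product. -/
def dotPerp (X : Submodule F (Fin n → F)) : Submodule F (Fin n → F) where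
  carrier := {x | ∀ y ∈ X, x ⬝ᵥ y = 0}
  add_mem' := fun {a b} ha hb y hy => by rw [add_dotProduct, ha y hy, hb y hy, add_zero]
  zero_mem' := fun y _ => zero_dotProduct y
  smul_mem' := fun c x hx y hy => by rw [smul_dotProduct, hx y hy, smul_zero]

/-- Condition (R1): `0 ≤ ρ(X) ≤ m dim X` for all `X`. -/
def CondR1 (m : ℕ) (ρ : Submodule F (Fin n → F) → ℤ) : Prop :=
  ∀ X, 0 ≤ ρ X ∧ ρ X ≤ (m : ℤ) * finrank F X

/-- Condition (R2): `ρ(X) ≤ ρ(Y)` whenever `X ⊆ Y`. -/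
def CondR2 (ρ : Submodule F (Fin n → F) → ℤ) : Prop :=
  ∀ X Y, X ≤ Y → ρ X ≤ ρ Y

/-- The dual function `ρ*(X) = ρ(X^⊥) + m dim X - ρ(E)`. -/
noncomputable def dualRank (m : ℕ) (ρ : Submodule F (Fin n → F) → ℤ) :
    Submodule F (Fin n → F) → ℤ :=
  fun X => ρ (dotPerp X) + (m : ℤ) * finrank F X - ρ ⊤

/-- `(F ^ n, ρ)` is a `(q, m)`-demi-polymatroid, where `q` is the cardinality of `F`. -/
structure IsDemiPolymatroid (m : ℕ) (ρ : Submodule F (Fin n → F) → ℤ) : Prop where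
  r1 : CondR1 m ρ
  r2 : CondR2 ρ
  dual_r1 : CondR1 m (dualRank m ρ)
  dual_r2 : CondR2 (dualRank m ρ)

/-- The conullity function `ν*(X) = m dim X - ρ*(X)`. -/
noncomputable def conullity (m : ℕ) (ρ : Submodule F (Fin n → F) → ℤ) :
    Submodule F (Fin n → F) → ℤ :=
  fun X => (m : ℤ) * finrank F X - dualRank m ρ X

/-- The generalized weight `d_r(P) = min {dim X : ν*(X) ≥ r}` of `P = (F ^ n, ρ)`, for
`1 ≤ r ≤ ρ(E)`. For a demi-polymatroid the set is then nonempty, as it contains `dim E`. -/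
noncomputable def genWeight (m : ℕ) (ρ : Submodule F (Fin n → F) → ℤ) (r : ℤ) : ℕ :=
  sInf {d : ℕ | ∃ X : Submodule F (Fin n → F), r ≤ conullity m ρ X ∧ finrank F X = d}

/-! ### Delsarte codes: linear subspaces of the space of `m × n` matrices -/

/-- The row space of a matrix. -/
def rowSpace (M : Matrix (Fin m) (Fin n) F) : Submodule F (Fin n → F) :=
  Submodule.span F (Set.range M.row)

/-- The subcode `C(X)` of all matrices in `C` whose row space is contained in `X`. -/
def subcode (C : Submodule F (Matrix (Fin m) (Fin n) F)) (X : Submodule F (Fin n → F)) :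
    Submodule F (Matrix (Fin m) (Fin n) F) where
  carrier := {M | M ∈ C ∧ rowSpace M ≤ X}
  add_mem' := by
    rintro A B ⟨hA, hAX⟩ ⟨hB, hBX⟩
    refine ⟨C.add_mem hA hB, Submodule.span_le.2 ?_⟩
    rintro _ ⟨i, rfl⟩
    exact X.add_mem (hAX (Submodule.subset_span ⟨i, rfl⟩)) (hBX (Submodule.subset_span ⟨i, rfl⟩))
  zero_mem' := by
    refine ⟨C.zero_mem, Submodule.span_le.2 ?_⟩
    rintro _ ⟨i, rfl⟩
    exact X.zero_mem
  smul_mem' := by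
    rintro c A ⟨hA, hAX⟩
    refine ⟨C.smul_mem c hA, Submodule.span_le.2 ?_⟩
    rintro _ ⟨i, rfl⟩
    exact X.smul_mem c (hAX (Submodule.subset_span ⟨i, rfl⟩))

/-- `ρ_C(X) = dim C - dim C(X^⊥)`; the pair `(F ^ n, ρ_C)` is the polymatroid `P(C)`. -/
noncomputable def rhoCode (C : Submodule F (Matrix (Fin m) (Fin n) F)) :
    Submodule F (Fin n → F) → ℤ :=
  fun X => (finrank F C : ℤ) - finrank F (subcode C (dotPerp X))

/-- The code `C^T` of all transposes of matrices in `C`. -/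
def transposeCode (C : Submodule F (Matrix (Fin m) (Fin n) F)) :
    Submodule F (Matrix (Fin n) (Fin m) F) :=
  C.map (Matrix.transposeLinearEquiv (Fin m) (Fin n) F F).toLinearMap

/-- The trace dual `C^⊥` of all `N` with `Trace(M N^t) = 0` for every `M ∈ C`. -/
def traceDual (C : Submodule F (Matrix (Fin m) (Fin n) F)) :
    Submodule F (Matrix (Fin m) (Fin n) F) where
  carrier := {N | ∀ M ∈ C, (M * N.transpose).trace = 0}
  add_mem' := fun {A B} hA hB M hM => by
    rw [Matrix.transpose_add, Matrix.mul_add, Matrix.trace_add, hA M hM, hB M hM, add_zero]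
  zero_mem' := fun M _ => by rw [Matrix.transpose_zero, Matrix.mul_zero, Matrix.trace_zero]
  smul_mem' := fun c A hA M hM => by
    rw [Matrix.transpose_smul, Matrix.mul_smul, Matrix.trace_smul, hA M hM, smul_zero]

/-- The maximum rank of a matrix in `A`; the set of ranks is nonempty and bounded by `n`. -/
noncomputable def maxRank (A : Submodule F (Matrix (Fin m) (Fin n) F)) : ℕ :=
  sSup {k : ℕ | ∃ M ∈ A, M.rank = k}

/-- Optimal anticodes: `dim A = m * maxrank(A)`. -/
def IsOptimalAnticode (A : Submodule F (Matrix (Fin m) (Fin n) F)) : Prop :=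
  finrank F A = m * maxRank A

/-- Ravagnani's generalized weights
`a_r(C) = (1/m) min {dim A : A an optimal anticode with dim (A ∩ C) ≥ r}`, for `1 ≤ r ≤ dim C`.
For `n ≤ m` the set is then nonempty, as the whole matrix space is an optimal anticode. -/
noncomputable def anticodeWeight (C : Submodule F (Matrix (Fin m) (Fin n) F)) (r : ℤ) : ℚ :=
  ((sInf {d : ℕ | ∃ A : Submodule F (Matrix (Fin m) (Fin n) F), IsOptimalAnticode A ∧
      r ≤ finrank F (A ⊓ C : Submodule F (Matrix (Fin m) (Fin n) F)) ∧ finrank F A = d} : ℕ) : ℚ) / m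

/-- The set `W_s = {a_r(C) : 1 ≤ r ≤ dim C, r ≡ s mod m}`. -/
def weightSet (C : Submodule F (Matrix (Fin m) (Fin n) F)) (s : ℤ) : Set ℚ :=
  {a | ∃ r : ℤ, 1 ≤ r ∧ r ≤ finrank F C ∧ r ≡ s [ZMOD m] ∧ a = anticodeWeight C r}

/-- The set `{n + 1 - a_r(C) : 1 ≤ r ≤ dim C, r ≡ s mod m}`. -/
def weightSetBar (C : Submodule F (Matrix (Fin m) (Fin n) F)) (s : ℤ) : Set ℚ :=
  {a | ∃ r : ℤ, 1 ≤ r ∧ r ≤ finrank F C ∧ r ≡ s [ZMOD m] ∧ a = n + 1 - anticodeWeight C r}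

end RankMetric

open RankMetric

/-! Put ν(X) = max(dim C(X), dim C^T(X)), called `maxSubcodeDim`. Both terms are monotone in X and
grow by at most m per dimension (`finrank_subcode_add_le`), hence so does ν. Since ρ(X) = K - ν(X^⊥)
and ρ*(X) = m dim X - ν(X), the axioms follow. The weights d_r split because ν(X) ≥ r says that one
of the two terms is at least r.

For Wei duality the a_r must be tied to ν. The crux is that an optimal anticode of square matrices
consists of matrices whose row spaces, or whose column spaces, lie in one X with m dim X at most its
dimension (`exists_le_subcode_or`). A space of dimension mr with ranks at most r < m has at least mr
pivots (leading positions), and a permutation graph meets them at most r times, because matrices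
leading along the graph combine into one of large rank. Averaging over translates then forces the
pivots to fill r rows or r columns (`eq_rows_or_columns`). So r rows (or columns) determine the
matrix, and the rank bound makes all others fixed linear combinations of them
(`exists_eq_sum_smul`). Hence a_r is the least dim X with ν(X) ≥ r.

Let g(k) be the maximum of ν in dimension k. For 1 ≤ k ≤ m, a_t(C) = m+1-k means that t lies in
(g(m-k), g(m+1-k)]. By the MacWilliams relation `finrank_subcode_traceDual_add`, a_r(C^⊥) = k means
that r+K-mk lies in (g(m+1-k)-m, g(m-k)]. These adjacent intervals form one of length m, so each
residue class mod m has its representative in exactly one of them. -/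

namespace RankMetric

variable {F : Type*} [Field F] {m n : ℕ}

/-! ### Subsets of a square grid meeting every permutation in few points -/

/-- A subset of an `m × m` grid with at least `m * r` points that meets the graph of every
permutation in at most `r` points meets each of them in exactly `r` points. -/
theorem card_filter_perm_eq (hm : 0 < m) {r : ℕ} {P : Finset (Fin m × Fin m)}
    (hP : ∀ σ : Equiv.Perm (Fin m), (Finset.univ.filter fun i => (i, σ i) ∈ P).card ≤ r)
    (hcard : m * r ≤ P.card) (σ : Equiv.Perm (Fin m)) :
    (Finset.univ.filter fun i => (i, σ i) ∈ P).card = r := by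
  have : NeZero m := ⟨hm.ne'⟩
  -- The m cyclic translates of the graph of `σ` partition the grid.
  have hsum : ∑ c : Fin m, (Finset.univ.filter fun i => (i, σ i + c) ∈ P).card = P.card := by
    simp_rw [Finset.card_filter]
    rw [Finset.sum_comm]
    have h1 : ∀ i : Fin m, (∑ c : Fin m, if (i, σ i + c) ∈ P then 1 else 0) =
        ∑ j : Fin m, if (i, j) ∈ P then 1 else 0 := fun i =>
      Equiv.sum_comp (Equiv.addLeft (σ i)) fun j => if (i, j) ∈ P then 1 else 0
    rw [Finset.sum_congr rfl fun i _ => h1 i, ← Fintype.sum_prod_type'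
      (f := fun i j => if (i, j) ∈ P then 1 else 0), ← Finset.card_filter]
    simp
  have hle : ∀ c ∈ (Finset.univ : Finset (Fin m)),
      (Finset.univ.filter fun i => (i, σ i + c) ∈ P).card ≤ r :=
    fun c _ => hP (σ.trans (Equiv.addRight c))
  have heq : ∑ c : Fin m, (Finset.univ.filter fun i => (i, σ i + c) ∈ P).card =
      ∑ _c : Fin m, r := by
    refine le_antisymm (Finset.sum_le_sum hle) ?_
    rw [hsum]
    simpa using hcard
  simpa using (Finset.sum_eq_sum_iff_of_le hle).1 heq 0 (Finset.mem_univ _)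

/-- If every permutation meets `P` in the same number of points, the indicator of `P` has vanishing
mixed differences. -/
theorem indicator_exchange {r : ℕ} {P : Finset (Fin m × Fin m)}
    (hP : ∀ σ : Equiv.Perm (Fin m), (Finset.univ.filter fun i => (i, σ i) ∈ P).card = r)
    (i k j l : Fin m) :
    (if (i, j) ∈ P then 1 else 0) + (if (k, l) ∈ P then 1 else 0) =
      (if (i, l) ∈ P then 1 else 0) + (if (k, j) ∈ P then 1 else 0 : ℕ) := by
  rcases eq_or_ne i k with rfl | hik
  · exact add_comm _ _
  rcases eq_or_ne j l with rfl | hjl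
  · rfl
  obtain ⟨σ, hi, hk⟩ : ∃ σ : Equiv.Perm (Fin m), σ i = j ∧ σ k = l := by
    refine ⟨(Equiv.swap i j).trans (Equiv.swap (Equiv.swap i j k) l), ?_, ?_⟩
    · have h : j ≠ Equiv.swap i j k := by
        intro h
        exact hik ((Equiv.swap i j).injective (by rw [← h, Equiv.swap_apply_left]))
      simp [Equiv.swap_apply_of_ne_of_ne h hjl]
    · simp
  have h1 := hP σ
  -- The two permutations differ only at `i` and `k`, so comparing their counts leaves the four
  -- corners of a rectangle.
  have h2 := hP ((Equiv.swap i k).trans σ)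
  rw [← h2] at h1
  simp_rw [Finset.card_filter] at h1
  have hk' : k ∈ Finset.univ.erase i := by simp [hik.symm]
  rw [← Finset.add_sum_erase _ _ (Finset.mem_univ i), ← Finset.add_sum_erase _ _ hk',
    ← Finset.add_sum_erase Finset.univ (fun x => if (x, (Equiv.trans (Equiv.swap i k) σ) x) ∈ P
      then 1 else 0) (Finset.mem_univ i), ← Finset.add_sum_erase _ _ hk'] at h1
  have h3 : ∀ x ∈ (Finset.univ.erase i).erase k,
      (if (x, σ x) ∈ P then 1 else 0 : ℕ) =
        if (x, ((Equiv.swap i k).trans σ) x) ∈ P then 1 else 0 := by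
    intro x hx
    simp only [Finset.mem_erase] at hx
    rw [Equiv.trans_apply, Equiv.swap_apply_of_ne_of_ne hx.2.1 hx.1]
  rw [Finset.sum_congr rfl h3] at h1
  simp only [Equiv.trans_apply, Equiv.swap_apply_left, Equiv.swap_apply_right, hi, hk] at h1
  omega

/-- A subset of an `m × m` grid with at least `m * r` points that meets the graph of every
permutation in at most `r` points is a union of `r` rows or a union of `r` columns. -/
theorem eq_rows_or_columns (hm : 0 < m) {r : ℕ} {P : Finset (Fin m × Fin m)}
    (hP : ∀ σ : Equiv.Perm (Fin m), (Finset.univ.filter fun i => (i, σ i) ∈ P).card ≤ r)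
    (hcard : m * r ≤ P.card) :
    ∃ R : Finset (Fin m), R.card = r ∧ ((∀ i j, (i, j) ∈ P ↔ i ∈ R) ∨ ∀ i j, (i, j) ∈ P ↔ j ∈ R) := by
  have : NeZero m := ⟨hm.ne'⟩
  have heq := card_filter_perm_eq hm hP hcard
  have hex := indicator_exchange heq
  have hiff : ∀ i k j l : Fin m, (i, j) ∈ P → (k, l) ∈ P → (i, l) ∉ P → (k, j) ∈ P → False := by
    intro i k j l h1 h2 h3 h4
    have := hex i k j l
    simp [h1, h2, h3, h4] at this
  by_cases h : ∀ i j l, (i, j) ∈ P → (i, l) ∈ P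
  -- The diagonal meets every row and every column once, so it reads off which of them are full, and
  -- the identity permutation counts them.
  · refine ⟨Finset.univ.filter fun i => (i, i) ∈ P, heq (Equiv.refl _), Or.inl fun i j => ?_⟩
    simp only [Finset.mem_filter, Finset.mem_univ, true_and]
    exact ⟨h _ _ _, h _ _ _⟩
  · push Not at h
    obtain ⟨i, j, l, h1, h2⟩ := h
    have hj : ∀ k, (k, j) ∈ P := by
      intro k
      have := hex i k j l
      by_contra h3
      simp [h1, h2, h3] at this
    have hcol : ∀ a b c, (a, c) ∈ P → (b, c) ∈ P := by
      intro a b c hac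
      have := hex a b j c
      by_contra h3
      simp [hj a, hj b, hac, h3] at this
    refine ⟨Finset.univ.filter fun i => (i, i) ∈ P, heq (Equiv.refl _), Or.inr fun i j => ?_⟩
    simp only [Finset.mem_filter, Finset.mem_univ, true_and]
    exact ⟨hcol _ _ _, hcol _ _ _⟩

/-! ### Pivots of a space of matrices -/

/-- Rows of a matrix that are linearly independent bound its rank from below. -/
theorem card_le_rank_of_linearIndepOn {M : Matrix (Fin m) (Fin n) F} {S : Finset (Fin m)}
    (h : LinearIndepOn F M.row (S : Set (Fin m))) : S.card ≤ M.rank := by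
  rw [Matrix.rank_eq_finrank_span_row]
  have h1 : finrank F (Submodule.span F (Set.range fun i : (S : Set (Fin m)) => M.row i)) = S.card :=
    (finrank_span_eq_card h).trans (by simp)
  rw [← h1]
  refine Submodule.finrank_mono (Submodule.span_mono ?_)
  rintro _ ⟨i, rfl⟩
  exact ⟨i, rfl⟩

/-- Replacing one vector `w` of an independent family by `u` or by `u + w` keeps it independent, for
one of the two choices at least. -/
theorem exists_smul_linearIndepOn {V ι : Type*} [AddCommGroup V] [Module F V] {S : Set ι} {k : ι}
    (hk : k ∈ S) {v : ι → V} (hv : LinearIndepOn F v S) (u : V) :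
    ∃ t : F, ∀ v' : ι → V, (∀ i ∈ S, i ≠ k → v' i = v i) → v' k = u + t • v k →
      LinearIndepOn F v' S := by
  have hS : insert k (S \ {k}) = S := by simp [Set.insert_eq_of_mem hk]
  have hkS : k ∉ S \ {k} := by simp
  rw [← hS, linearIndepOn_insert hkS] at hv
  -- If `u` and `u + v k` were both in the span of the other vectors, so would be `v k`.
  have key : ∃ t : F, u + t • v k ∉ Submodule.span F (v '' (S \ {k})) := by
    by_cases hu : u ∈ Submodule.span F (v '' (S \ {k}))
    · refine ⟨1, fun h => hv.2 ?_⟩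
      simpa using Submodule.sub_mem _ h hu
    · exact ⟨0, by simpa using hu⟩
  obtain ⟨t, ht⟩ := key
  refine ⟨t, fun v' h1 h2 => ?_⟩
  rw [← hS, linearIndepOn_insert hkS]
  have h3 : Set.EqOn v v' (S \ {k}) := fun i hi => (h1 i hi.1 hi.2).symm
  refine ⟨hv.1.congr h3, ?_⟩
  rw [← h3.image_eq, h2]
  exact ht

/-- If matrices `A i` in `W` vanish on the rows before the `i`th, and their `i`th rows are independent
for `i ∈ S`, then `W` contains a matrix of rank at least `|S|`. -/
theorem exists_card_le_rank {W : Submodule F (Matrix (Fin m) (Fin n) F)} {S : Finset (Fin m)}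
    {A : Fin m → Matrix (Fin m) (Fin n) F} (hA : ∀ i, A i ∈ W)
    (hzero : ∀ i, ∀ i' < i, A i i' = 0)
    (hind : LinearIndepOn F (fun i => A i i) (S : Set (Fin m))) :
    ∃ M ∈ W, S.card ≤ M.rank := by
  -- `M` is corrected from the top row down: adding a multiple of `A k` leaves the rows before `k`
  -- alone, while rows not yet reached are represented by the `A i i`.
  have key : ∀ k : ℕ, k ≤ m → ∃ M ∈ W,
      LinearIndepOn F (fun i : Fin m => if (i : ℕ) < k then M i else A i i) (S : Set (Fin m)) := by
    intro k
    induction k with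
    | zero => exact fun _ => ⟨0, W.zero_mem, by simpa using hind⟩
    | succ k ih =>
      intro hk
      obtain ⟨M, hM, h⟩ := ih (by omega)
      by_cases hkS : (⟨k, hk⟩ : Fin m) ∈ S
      · obtain ⟨t, ht⟩ := exists_smul_linearIndepOn (Finset.mem_coe.2 hkS) h (M ⟨k, hk⟩)
        refine ⟨M + t • A ⟨k, hk⟩, W.add_mem hM (W.smul_mem _ (hA _)), ht _ ?_ ?_⟩
        · intro i _ hik
          have hne : (i : ℕ) ≠ k := fun h => hik (Fin.ext h)
          by_cases hlt : (i : ℕ) < k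
          · have h0 : A ⟨k, hk⟩ i = 0 := hzero _ _ hlt
            have : (M + t • A ⟨k, hk⟩) i = M i := by
              change M i + t • A ⟨k, hk⟩ i = M i
              rw [h0, smul_zero, add_zero]
            simp [hlt, Nat.lt_succ_of_lt hlt, this]
          · have : ¬ (i : ℕ) < k + 1 := by omega
            simp [hlt, this]
        · simp only [Nat.lt_succ_self, if_true, lt_irrefl, if_false]
          rfl
      · refine ⟨M, hM, h.congr ?_⟩
        intro i hi
        have hne : (i : ℕ) ≠ k := by
          rintro rfl
          exact hkS hi
        have : (i : ℕ) < k + 1 ↔ (i : ℕ) < k := by omega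
        simp [this]
  obtain ⟨M, hM, h⟩ := key m le_rfl
  refine ⟨M, hM, card_le_rank_of_linearIndepOn (h.congr fun i _ => ?_)⟩
  simp [Matrix.row]

/-- Vectors whose first nonzero coordinates are at distinct places are independent. -/
theorem linearIndepOn_of_leading {ι : Type*} {S : Finset ι} {v : ι → Fin n → F} {σ : ι → Fin n}
    (hσ : Set.InjOn σ S) (hne : ∀ i ∈ S, v i (σ i) ≠ 0)
    (hlt : ∀ i ∈ S, ∀ j < σ i, v i j = 0) : LinearIndepOn F v (S : Set ι) := by
  classical
  rw [linearIndepOn_finset_iff]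
  intro c hc
  by_contra! h
  -- At the earliest leading place in a nontrivial relation, only one term survives.
  obtain ⟨i, hi, hmin⟩ := Finset.exists_min_image (S.filter fun i => c i ≠ 0) σ
    (by obtain ⟨i, hi, h⟩ := h; exact ⟨i, by simp [hi, h]⟩)
  rw [Finset.mem_filter] at hi
  have h1 := congrFun hc (σ i)
  rw [Finset.sum_apply, Finset.sum_eq_single_of_mem i hi.1] at h1
  · simp [hi.2, hne i hi.1] at h1
  · intro k hk hki
    by_cases hck : c k = 0
    · simp [hck]
    · have h2 := hmin k (by simp [hk, hck])
      have h3 : σ i ≠ σ k := fun h => hki (hσ hk hi.1 h.symm)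
      simp [hlt k hk _ (lt_of_le_of_ne h2 h3)]

open Classical in
/-- The positions at which some matrix of `W` has its first nonzero entry, in the lexicographic
order. -/
noncomputable def pivots (W : Submodule F (Matrix (Fin m) (Fin n) F)) : Finset (Fin m × Fin n) :=
  Finset.univ.filter fun p => ∃ M ∈ W, M p.1 p.2 ≠ 0 ∧ (∀ i < p.1, M i = 0) ∧
    ∀ j < p.2, M p.1 j = 0

/-- The first nonzero entry of a nonzero element of `W` is itself at a pivot. -/
theorem eq_zero_of_forall_pivots {W : Submodule F (Matrix (Fin m) (Fin n) F)}
    {M : Matrix (Fin m) (Fin n) F} (hM : M ∈ W) (h : ∀ p ∈ pivots W, M p.1 p.2 = 0) : M = 0 := by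
  classical
  by_contra hne
  obtain ⟨i, hi, himin⟩ := Finset.exists_min_image (Finset.univ.filter fun i => M i ≠ 0) id
    (by
      by_contra hc
      rw [Finset.not_nonempty_iff_eq_empty, Finset.filter_eq_empty_iff] at hc
      exact hne (funext fun i => not_not.1 (hc (Finset.mem_univ i))))
  rw [Finset.mem_filter] at hi
  obtain ⟨j, hj, hjmin⟩ := Finset.exists_min_image (Finset.univ.filter fun j => M i j ≠ 0) id
    (by
      by_contra hc
      rw [Finset.not_nonempty_iff_eq_empty, Finset.filter_eq_empty_iff] at hc
      exact hi.2 (funext fun j => not_not.1 (hc (Finset.mem_univ j))))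
  rw [Finset.mem_filter] at hj
  refine hj.2 (h (i, j) ?_)
  simp only [pivots, Finset.mem_filter, Finset.mem_univ, true_and]
  refine ⟨M, hM, hj.2, fun k hk => ?_, fun k hk => ?_⟩
  · by_contra hc
    exact absurd (himin k (by simp [hc])) (not_le.2 hk)
  · by_contra hc
    exact absurd (hjmin k (by simp [hc])) (not_le.2 hk)

theorem finrank_le_card_pivots (W : Submodule F (Matrix (Fin m) (Fin n) F)) :
    finrank F W ≤ (pivots W).card := by
  let f : W →ₗ[F] (pivots W → F) :=
    { toFun := fun M p => M.1 p.1.1 p.1.2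
      map_add' := fun _ _ => rfl
      map_smul' := fun _ _ => rfl }
  have hf : Function.Injective f := by
    rw [injective_iff_map_eq_zero]
    intro M hM
    exact Subtype.ext (eq_zero_of_forall_pivots M.2 fun p hp => congrFun hM ⟨p, hp⟩)
  simpa using LinearMap.finrank_le_finrank_of_injective hf

/-- Choose for each pivot on the graph of `σ` a matrix leading there. The leading columns are
distinct, so the leading rows are independent and `exists_card_le_rank` applies. -/
theorem exists_card_pivots_perm_le_rank (W : Submodule F (Matrix (Fin m) (Fin m) F))
    (σ : Equiv.Perm (Fin m)) :
    ∃ M ∈ W, (Finset.univ.filter fun i => (i, σ i) ∈ pivots W).card ≤ M.rank := by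
  have h : ∀ i, ∃ A ∈ W, (∀ i' < i, A i' = 0) ∧
      ((i, σ i) ∈ pivots W → A i (σ i) ≠ 0 ∧ ∀ j < σ i, A i j = 0) := by
    intro i
    by_cases hi : (i, σ i) ∈ pivots W
    · have hi' := hi
      simp only [pivots, Finset.mem_filter, Finset.mem_univ, true_and] at hi'
      obtain ⟨A, hA, h1, h2, h3⟩ := hi'
      exact ⟨A, hA, h2, fun _ => ⟨h1, h3⟩⟩
    · exact ⟨0, W.zero_mem, fun _ _ => rfl, fun h => absurd h hi⟩
  choose A hA h1 h2 using h
  refine exists_card_le_rank hA h1 (linearIndepOn_of_leading σ.injective.injOn ?_ ?_)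
  · intro i hi
    exact (h2 i (by simpa using hi)).1
  · intro i hi
    exact (h2 i (by simpa using hi)).2

/-! ### Classification of optimal anticodes -/

/-! ### Linear maps sending independent families into their spans. -/

section Scalar

variable {V R : Type*} [AddCommGroup V] [Module F V] [Fintype R]

/-- Two independent vectors `s`, `w` and a smaller than full number of places: `s` extends to an
independent family whose span avoids `w`. -/
theorem exists_linearIndependent_notMem_span {s w : V} (hs : LinearIndependent F ![s, w])
    (hR : Fintype.card R < finrank F V) (l : R) :
    ∃ v : R → V, LinearIndependent F v ∧ v l = s ∧ w ∉ Submodule.span F (Set.range v) := by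
  classical
  -- Carrying `w` along as an extra member keeps it outside the span; the strict dimension bound
  -- leaves room for it.
  have key : ∀ k : ℕ, k + 1 < finrank F V → ∃ v : Fin (k + 1) → V, v 0 = s ∧
      LinearIndependent F (Fin.cons w v : Fin (k + 1 + 1) → V) := by
    intro k
    induction k with
    | zero =>
      intro _
      refine ⟨fun _ => s, rfl, ?_⟩
      have h := LinearIndependent.pair_symm_iff.1 hs
      have hcons : (Fin.cons w (fun _ => s) : Fin (0 + 1 + 1) → V) = ![w, s] := by
        ext i
        fin_cases i <;> rfl
      rw [hcons]
      exact h
    | succ k ih =>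
      intro hk
      obtain ⟨v, hv0, hv⟩ := ih (by omega)
      obtain ⟨y, hy⟩ := exists_linearIndependent_snoc_of_lt_finrank hv hk
      refine ⟨Fin.snoc v y, ?_, ?_⟩
      · rw [← hv0, ← Fin.castSucc_zero, Fin.snoc_castSucc]
      · rw [Fin.cons_snoc_eq_snoc_cons]
        exact hy
  obtain ⟨k, hk⟩ : ∃ k, Fintype.card R = k + 1 :=
    Nat.exists_eq_succ_of_ne_zero (Fintype.card_pos_iff.2 ⟨l⟩).ne'
  obtain ⟨v, hv0, hv⟩ := key k (hk ▸ hR)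
  rw [linearIndependent_finCons] at hv
  let e₀ : R ≃ Fin (k + 1) := Fintype.equivFinOfCardEq hk
  let e : R ≃ Fin (k + 1) := e₀.trans (Equiv.swap (e₀ l) 0)
  refine ⟨v ∘ e, (linearIndependent_equiv e).2 hv.1, ?_, ?_⟩
  · simp [e, hv0]
  · rw [e.surjective.range_comp]
    exact hv.2

/-- A linear map `V ^ R → V`, where `|R| < dim V`, that sends each independent family into its span is
a fixed linear combination of the coordinates. -/
theorem exists_eq_sum_smul [DecidableEq R] (φ : (R → V) →ₗ[F] V)
    (hR : Fintype.card R < finrank F V)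
    (hφ : ∀ v : R → V, LinearIndependent F v → φ v ∈ Submodule.span F (Set.range v)) :
    ∃ c : R → F, ∀ v, φ v = ∑ k, c k • v k := by
  have key : ∀ k : R, ∃ c : F, ∀ s : V, φ (Pi.single k s) = c • s := by
    intro k
    obtain ⟨c, hc⟩ := LinearMap.exists_eq_smul_id_of_forall_notLinearIndependent
      (f := φ ∘ₗ LinearMap.single F (fun _ : R => V) k) fun s hs => by
        simp only [LinearMap.comp_apply, LinearMap.single_apply] at hs
        by_cases hl : ∃ l, l ≠ k
        · obtain ⟨l, hl⟩ := hl
          obtain ⟨v, hv, hvl, hw⟩ := exists_linearIndependent_notMem_span hs hR l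
          -- As `s = v l`, this replaces `v k` by `v k + v l`, which preserves independence and does
          -- not enlarge the span. By linearity `φ (Pi.single k s)` then lies in the span of `v`,
          -- which was chosen to avoid it.
          have hupd : v + Pi.single k s = Function.update v k (v k + s) := by
            ext i
            by_cases hik : i = k
            · subst hik; simp
            · simp [hik]
          have hv' : LinearIndependent F (v + Pi.single k s) := by
            rw [hupd]
            refine hv.update k _ ⟨1, one_mem _, Finsupp.single k 1 + Finsupp.single l 1, ?_, ?_⟩
            · simp [hl]
            · simp [hvl]
          have h1 := hφ _ hv'
          have h2 : Submodule.span F (Set.range (v + Pi.single k s)) ≤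
              Submodule.span F (Set.range v) := by
            rw [Submodule.span_le]
            rintro _ ⟨i, rfl⟩
            refine Submodule.add_mem _ (Submodule.subset_span ⟨i, rfl⟩) ?_
            by_cases hik : i = k
            · subst hik
              simpa [← hvl] using Submodule.subset_span (R := F) (Set.mem_range_self (f := v) l)
            · simp [hik]
          rw [map_add] at h1
          refine hw ?_
          simpa using Submodule.sub_mem _ (h2 h1) (hφ v hv)
        · push Not at hl
          obtain ⟨v, hv, hvk, hw⟩ := exists_linearIndependent_notMem_span hs hR k
          have : Pi.single k s = v := by
            ext i
            rw [hl i, hvk, Pi.single_eq_same]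
          rw [this] at hw
          exact hw (hφ v hv)
    exact ⟨c, fun s => by simpa using LinearMap.congr_fun hc s⟩
  choose c hc using key
  refine ⟨c, fun v => ?_⟩
  conv_lhs => rw [← Finset.univ_sum_single v, map_sum]
  exact Finset.sum_congr rfl fun k _ => hc k _

end Scalar

theorem mem_subcode {C : Submodule F (Matrix (Fin m) (Fin n) F)} {X : Submodule F (Fin n → F)}
    {M : Matrix (Fin m) (Fin n) F} : M ∈ subcode C X ↔ M ∈ C ∧ ∀ i, M i ∈ X := by
  refine and_congr_right fun _ => ?_
  rw [rowSpace, Submodule.span_le]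
  exact Set.range_subset_iff

theorem mem_transposeCode {C : Submodule F (Matrix (Fin m) (Fin n) F)}
    {M : Matrix (Fin n) (Fin m) F} : M ∈ transposeCode C ↔ M.transpose ∈ C := by
  constructor
  · rintro ⟨N, hN, rfl⟩
    exact hN
  · exact fun h => ⟨_, h, rfl⟩

theorem transposeCode_transposeCode (C : Submodule F (Matrix (Fin m) (Fin n) F)) :
    transposeCode (transposeCode C) = C := by
  ext M
  simp [mem_transposeCode]

theorem finrank_transposeCode (C : Submodule F (Matrix (Fin m) (Fin n) F)) :
    finrank F (transposeCode C) = finrank F C :=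
  LinearEquiv.finrank_map_eq (Matrix.transposeLinearEquiv (Fin m) (Fin n) F F) C

/-- A space of matrices of rank at most `r < n`, of dimension `n * r`, whose elements are determined by
`r` of their rows: the column spaces of all its elements lie in one space of dimension `r`. -/
theorem exists_transposeCode_le {r : ℕ} (hr : r < n) {W : Submodule F (Matrix (Fin m) (Fin n) F)}
    (hrank : ∀ M ∈ W, M.rank ≤ r) (hdim : finrank F W = n * r) {R : Finset (Fin m)}
    (hR : R.card = r) (hinj : ∀ M ∈ W, (∀ i ∈ R, M i = 0) → M = 0) :
    ∃ X : Submodule F (Fin m → F), finrank F X ≤ r ∧ transposeCode W ≤ subcode ⊤ X := by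
  let f : W →ₗ[F] (R → Fin n → F) :=
    { toFun := fun M i => M.1 i
      map_add' := fun _ _ => rfl
      map_smul' := fun _ _ => rfl }
  have hf : Function.Injective f := by
    rw [injective_iff_map_eq_zero]
    intro M hM
    exact Subtype.ext (hinj M.1 M.2 fun i hi => congrFun hM ⟨i, hi⟩)
  -- The dimension hypothesis makes restriction to the rows in `R` bijective, so these rows can be
  -- prescribed freely.
  have hfd : finrank F W = finrank F (R → Fin n → F) := by
    rw [hdim, finrank_pi_fintype]
    simp [hR, mul_comm]
  let e := LinearEquiv.ofInjectiveOfFinrankEq f hf hfd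
  have he : ∀ (M : W) (k : R), e M k = M.1 k := fun M k => rfl
  have key : ∀ i : Fin m, ∃ c : R → F, ∀ M : W, M.1 i = ∑ k, c k • M.1 k := by
    intro i
    let φ : (R → Fin n → F) →ₗ[F] (Fin n → F) :=
      { toFun := fun N => (e.symm N).1 i
        map_add' := fun N N' => by rw [map_add]; rfl
        map_smul' := fun a N => by rw [map_smul]; rfl }
    obtain ⟨c, hc⟩ := exists_eq_sum_smul φ (by simpa [hR] using hr) (by
      intro N hN
      have hrow : ∀ k, N k = (e.symm N).1 k := fun k => by rw [← he, e.apply_symm_apply]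
      have hle : Submodule.span F (Set.range N) ≤
          Submodule.span F (Set.range (e.symm N).1.row) := by
        refine Submodule.span_mono ?_
        rintro _ ⟨k, rfl⟩
        exact ⟨k, (hrow k).symm⟩
      -- Independent rows in `R` already use up the rank `r`, so they span the whole row space.
      have heq := Submodule.eq_of_le_of_finrank_le hle (by
        rw [← Matrix.rank_eq_finrank_span_row, finrank_span_eq_card hN]
        simpa [hR] using hrank _ (e.symm N).2)
      rw [heq]
      exact Submodule.subset_span ⟨i, rfl⟩)
    refine ⟨c, fun M => ?_⟩
    have h := hc (e M)
    simp only [he] at h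
    rw [← h]
    simp [φ]
  choose c hc using key
  refine ⟨Submodule.span F (Set.range fun (k : R) (i : Fin m) => c i k), ?_, ?_⟩
  · refine (finrank_range_le_card _).trans ?_
    simp [hR]
  · intro M hM
    rw [mem_transposeCode] at hM
    refine mem_subcode.2 ⟨trivial, fun j => ?_⟩
    have : M j = ∑ k : R, M j k • fun i => c i k := by
      ext i
      have := congrFun (hc i ⟨_, hM⟩) j
      simpa [mul_comm] using this
    rw [this]
    exact Submodule.sum_mem _ fun k _ =>
      Submodule.smul_mem _ _ (Submodule.subset_span ⟨k, rfl⟩)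

/-- A space of `m × m` matrices of rank at most `r`, of dimension `m * r`, consists of matrices whose
row spaces, or whose column spaces, all lie in one space of dimension `r`. -/
theorem exists_le_subcode_or {r : ℕ} {W : Submodule F (Matrix (Fin m) (Fin m) F)}
    (hrank : ∀ M ∈ W, M.rank ≤ r) (hdim : finrank F W = m * r) :
    ∃ X : Submodule F (Fin m → F), finrank F X ≤ r ∧
      (W ≤ subcode ⊤ X ∨ transposeCode W ≤ subcode ⊤ X) := by
  rcases le_or_gt m r with h | hr
  · exact ⟨⊤, by simpa using h, Or.inl fun M _ => mem_subcode.2 ⟨trivial, fun _ => trivial⟩⟩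
  obtain ⟨R, hR, h | h⟩ := eq_rows_or_columns (P := pivots W) (r := r) (by omega)
    (fun σ => by
      obtain ⟨M, hM, h⟩ := exists_card_pivots_perm_le_rank W σ
      exact h.trans (hrank M hM)) (hdim ▸ finrank_le_card_pivots W)
  · obtain ⟨X, hX, hle⟩ := exists_transposeCode_le hr hrank hdim hR fun M hM h0 =>
      eq_zero_of_forall_pivots hM fun p hp => congrFun (h0 p.1 ((h p.1 p.2).1 hp)) p.2
    exact ⟨X, hX, Or.inr hle⟩
  · obtain ⟨X, hX, hle⟩ := exists_transposeCode_le (W := transposeCode W) hr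
      (fun M hM => by
        rw [← Matrix.rank_transpose]
        exact hrank _ (mem_transposeCode.1 hM))
      ((finrank_transposeCode W).trans hdim) hR fun M hM h0 =>
        Matrix.transpose_injective
          (eq_zero_of_forall_pivots (mem_transposeCode.1 hM) fun p hp =>
            congrFun (h0 p.2 ((h p.1 p.2).1 hp)) p.1)
    rw [transposeCode_transposeCode] at hle
    exact ⟨X, hX, Or.inl hle⟩

/-! ### Orthogonal complements -/

section DotPerp

/-- The standard dot product as a bilinear form. -/
def dotForm (F : Type*) [Field F] (n : ℕ) : LinearMap.BilinForm F (Fin n → F) :=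
  LinearMap.mk₂ F (fun x y => x ⬝ᵥ y) add_dotProduct smul_dotProduct dotProduct_add
    fun c x y => dotProduct_smul c x y

theorem dotForm_isRefl : (dotForm F n).IsRefl := fun x y h => by
  change y ⬝ᵥ x = 0
  rwa [dotProduct_comm]

theorem dotForm_nondegenerate : (dotForm F n).Nondegenerate := by
  refine (LinearMap.IsRefl.nondegenerate_iff_separatingLeft (B := dotForm F n)
    dotForm_isRefl).2 ?_
  exact fun x h => dotProduct_eq_zero x h

theorem dotPerp_eq_orthogonal (X : Submodule F (Fin n → F)) :
    dotPerp X = (dotForm F n).orthogonal X := by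
  ext x
  refine forall₂_congr fun y _ => ?_
  rw [dotProduct_comm]
  rfl

theorem finrank_add_finrank_dotPerp (X : Submodule F (Fin n → F)) :
    finrank F X + finrank F (dotPerp X) = n := by
  have h1 := LinearMap.BilinForm.finrank_orthogonal (dotForm_nondegenerate (F := F) (n := n)) X
  have h2 := Submodule.finrank_le X
  rw [finrank_fin_fun] at h1 h2
  rw [dotPerp_eq_orthogonal]
  omega

theorem dotPerp_dotPerp (X : Submodule F (Fin n → F)) : dotPerp (dotPerp X) = X := by
  rw [dotPerp_eq_orthogonal, dotPerp_eq_orthogonal]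
  exact LinearMap.BilinForm.orthogonal_orthogonal dotForm_nondegenerate dotForm_isRefl X

theorem dotPerp_anti {X Y : Submodule F (Fin n → F)} (h : X ≤ Y) : dotPerp Y ≤ dotPerp X :=
  fun _ hx y hy => hx y (h hy)

theorem dotPerp_top : dotPerp (⊤ : Submodule F (Fin n → F)) = ⊥ := by
  have h := finrank_add_finrank_dotPerp (⊤ : Submodule F (Fin n → F))
  rw [finrank_top, finrank_fin_fun] at h
  exact Submodule.finrank_eq_zero.1 (by omega)

theorem exists_le_finrank_eq_succ {X : Submodule F (Fin n → F)} (h : finrank F X < n) :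
    ∃ Y, X ≤ Y ∧ finrank F Y = finrank F X + 1 := by
  obtain ⟨v, hv⟩ : ∃ v, v ∉ X := by
    by_contra! hc
    rw [(eq_top_iff.2 fun v _ => hc v : X = ⊤), finrank_top, finrank_fin_fun] at h
    exact lt_irrefl _ h
  exact ⟨_, le_sup_left, Submodule.finrank_sup_span_singleton hv⟩

theorem exists_finrank_eq {k : ℕ} (h : k ≤ n) :
    ∃ X : Submodule F (Fin n → F), finrank F X = k := by
  induction k with
  | zero => exact ⟨⊥, finrank_bot _ _⟩
  | succ k ih =>
    obtain ⟨X, hX⟩ := ih (by omega)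
    obtain ⟨Y, -, hY⟩ := exists_le_finrank_eq_succ (X := X) (by omega)
    exact ⟨Y, by omega⟩

end DotPerp

/-! ### Trace duality of codes. -/

section TraceDual

/-- The trace form `Trace (M Nᵗ)` on matrices. -/
def matrixTraceForm (F : Type*) [Field F] (m n : ℕ) :
    LinearMap.BilinForm F (Matrix (Fin m) (Fin n) F) :=
  LinearMap.mk₂ F (fun M N => (M * N.transpose).trace)
    (fun M M' N => by rw [Matrix.add_mul, Matrix.trace_add])
    (fun c M N => by rw [Matrix.smul_mul, Matrix.trace_smul])
    (fun M N N' => by rw [Matrix.transpose_add, Matrix.mul_add, Matrix.trace_add])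
    (fun c M N => by rw [Matrix.transpose_smul, Matrix.mul_smul, Matrix.trace_smul])

theorem trace_mul_transpose_comm (M N : Matrix (Fin m) (Fin n) F) :
    (M * N.transpose).trace = (N * M.transpose).trace := by
  rw [← Matrix.trace_transpose, Matrix.transpose_mul, Matrix.transpose_transpose]

theorem trace_mul_transpose_eq_sum (M N : Matrix (Fin m) (Fin n) F) :
    (M * N.transpose).trace = ∑ i, M i ⬝ᵥ N i := rfl

theorem matrixTraceForm_isRefl : (matrixTraceForm F m n).IsRefl := fun M N h => by
  change (N * M.transpose).trace = 0
  rwa [trace_mul_transpose_comm]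

theorem matrixTraceForm_nondegenerate : (matrixTraceForm F m n).Nondegenerate := by
  refine (LinearMap.IsRefl.nondegenerate_iff_separatingLeft (B := matrixTraceForm F m n)
    matrixTraceForm_isRefl).2 ?_
  intro M h
  ext i j
  have h1 := h (Matrix.single i j (1 : F))
  change (M * (Matrix.single i j (1 : F)).transpose).trace = 0 at h1
  rw [Matrix.transpose_single, Matrix.trace_mul_single] at h1
  simpa using h1

theorem traceDual_eq_orthogonal (C : Submodule F (Matrix (Fin m) (Fin n) F)) :
    traceDual C = (matrixTraceForm F m n).orthogonal C := rfl

theorem finrank_add_finrank_traceDual (C : Submodule F (Matrix (Fin m) (Fin n) F)) :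
    finrank F C + finrank F (traceDual C) = m * n := by
  have h1 := LinearMap.BilinForm.finrank_orthogonal
    (matrixTraceForm_nondegenerate (F := F) (m := m) (n := n)) C
  have h2 := Submodule.finrank_le C
  rw [finrank_matrix, Fintype.card_fin, Fintype.card_fin, finrank_self, mul_one] at h1 h2
  rw [traceDual_eq_orthogonal]
  omega

theorem traceDual_sup (C D : Submodule F (Matrix (Fin m) (Fin n) F)) :
    traceDual (C ⊔ D) = traceDual C ⊓ traceDual D := by
  ext N
  refine ⟨fun h => ⟨fun M hM => h M (Submodule.mem_sup_left hM),
    fun M hM => h M (Submodule.mem_sup_right hM)⟩, ?_⟩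
  rintro ⟨h1, h2⟩ M hM
  obtain ⟨A, hA, B, hB, rfl⟩ := Submodule.mem_sup.1 hM
  rw [Matrix.add_mul, Matrix.trace_add, h1 A hA, h2 B hB, add_zero]

theorem transposeCode_traceDual (C : Submodule F (Matrix (Fin m) (Fin n) F)) :
    transposeCode (traceDual C) = traceDual (transposeCode C) := by
  ext N
  rw [mem_transposeCode]
  constructor
  · intro h M hM
    rw [Matrix.trace_mul_comm, ← Matrix.trace_transpose, Matrix.transpose_mul,
      Matrix.transpose_transpose, Matrix.trace_mul_comm]
    have := h _ (mem_transposeCode.1 hM)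
    rw [Matrix.transpose_transpose, Matrix.trace_mul_comm] at this
    rwa [Matrix.trace_mul_comm, ← Matrix.trace_transpose, Matrix.transpose_mul,
      Matrix.transpose_transpose, Matrix.trace_mul_comm, trace_mul_transpose_comm] at this
  · intro h M hM
    have := h M.transpose (mem_transposeCode.2 (by simpa using hM))
    rw [Matrix.transpose_transpose]
    rwa [← Matrix.trace_transpose, Matrix.transpose_mul, Matrix.transpose_transpose,
      Matrix.transpose_transpose, Matrix.trace_mul_comm] at this

end TraceDual

/-! ### Dimensions of subcodes -/

theorem subcode_top_right (C : Submodule F (Matrix (Fin m) (Fin n) F)) : subcode C ⊤ = C := by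
  ext M
  simp [mem_subcode]

theorem subcode_bot_right (C : Submodule F (Matrix (Fin m) (Fin n) F)) : subcode C ⊥ = ⊥ := by
  rw [eq_bot_iff]
  intro M hM
  exact funext fun i => (mem_subcode.1 hM).2 i

theorem subcode_mono (C : Submodule F (Matrix (Fin m) (Fin n) F)) {X Y : Submodule F (Fin n → F)}
    (h : X ≤ Y) : subcode C X ≤ subcode C Y :=
  fun _ hM => ⟨hM.1, hM.2.trans h⟩

theorem finrank_subcode_top (X : Submodule F (Fin n → F)) :
    finrank F (subcode (⊤ : Submodule F (Matrix (Fin m) (Fin n) F)) X) = m * finrank F X := by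
  let e : subcode (⊤ : Submodule F (Matrix (Fin m) (Fin n) F)) X ≃ₗ[F] (Fin m → X) :=
    { toFun := fun M i => ⟨M.1 i, (mem_subcode.1 M.2).2 i⟩
      invFun := fun N => ⟨fun i => (N i).1, mem_subcode.2 ⟨trivial, fun i => (N i).2⟩⟩
      map_add' := fun _ _ => rfl
      map_smul' := fun _ _ => rfl }
  rw [e.finrank_eq, finrank_pi_fintype]
  simp

/-- Inside M(Y), the matrices with rows in Y, the spaces C(Y) and M(X) meet in C(X); compare
dimensions. -/
theorem finrank_subcode_add_le (C : Submodule F (Matrix (Fin m) (Fin n) F))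
    {X Y : Submodule F (Fin n → F)} (h : X ≤ Y) :
    finrank F (subcode C Y) + m * finrank F X ≤ finrank F (subcode C X) + m * finrank F Y := by
  have h1 := Submodule.finrank_sup_add_finrank_inf_eq (subcode C Y) (subcode ⊤ X)
  have h2 : subcode C Y ⊓ subcode ⊤ X = subcode C X := by
    ext M
    exact ⟨fun hM => ⟨hM.1.1, hM.2.2⟩, fun hM => ⟨⟨hM.1, hM.2.trans h⟩, trivial, hM.2⟩⟩
  have h3 : subcode C Y ⊔ subcode ⊤ X ≤ subcode ⊤ Y :=
    sup_le (fun M hM => ⟨trivial, hM.2⟩) (subcode_mono ⊤ h)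
  have h4 := Submodule.finrank_mono h3
  rw [h2, finrank_subcode_top] at h1
  rw [finrank_subcode_top] at h4
  omega

theorem traceDual_subcode_top (X : Submodule F (Fin n → F)) :
    traceDual (subcode (⊤ : Submodule F (Matrix (Fin m) (Fin n) F)) X) =
      subcode ⊤ (dotPerp X) := by
  symm
  refine Submodule.eq_of_le_of_finrank_le ?_ ?_
  · intro N hN M hM
    rw [trace_mul_transpose_comm, trace_mul_transpose_eq_sum]
    exact Finset.sum_eq_zero fun i _ => (mem_subcode.1 hN).2 i _ ((mem_subcode.1 hM).2 i)
  · have h1 := finrank_add_finrank_traceDual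
      (subcode (⊤ : Submodule F (Matrix (Fin m) (Fin n) F)) X)
    have h2 := finrank_add_finrank_dotPerp X
    rw [finrank_subcode_top] at h1 ⊢
    have h3 : m * finrank F X + m * finrank F (dotPerp X) = m * n := by rw [← mul_add, h2]
    omega

/-- The MacWilliams-type relation between the subcodes of a code and of its dual. -/
theorem finrank_subcode_traceDual_add (C : Submodule F (Matrix (Fin m) (Fin n) F))
    (X : Submodule F (Fin n → F)) :
    finrank F (subcode (traceDual C) X) + finrank F C =
      m * finrank F X + finrank F (subcode C (dotPerp X)) := by
  -- Restricting rows to X is imposing orthogonality to all matrices with rows in X^⊥.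
  have h1 : subcode (traceDual C) X = traceDual (C ⊔ subcode ⊤ (dotPerp X)) := by
    rw [traceDual_sup, traceDual_subcode_top, dotPerp_dotPerp]
    ext M
    exact ⟨fun h => ⟨h.1, trivial, h.2⟩, fun h => ⟨h.1, h.2.2⟩⟩
  have h2 : C ⊓ subcode ⊤ (dotPerp X) = subcode C (dotPerp X) := by
    ext M
    exact ⟨fun h => ⟨h.1, h.2.2⟩, fun h => ⟨h.1, trivial, h.2⟩⟩
  have h3 := Submodule.finrank_sup_add_finrank_inf_eq C (subcode ⊤ (dotPerp X))
  have h4 := finrank_add_finrank_traceDual (C ⊔ subcode ⊤ (dotPerp X))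
  have h5 := finrank_add_finrank_dotPerp X
  rw [h2, finrank_subcode_top] at h3
  have h6 : m * finrank F X + m * finrank F (dotPerp X) = m * n := by rw [← mul_add, h5]
  rw [← h1] at h4
  omega

/-! ### Optimal anticodes of standard form -/

theorem rank_le_finrank_of_mem_subcode {C : Submodule F (Matrix (Fin m) (Fin n) F)}
    {X : Submodule F (Fin n → F)} {M : Matrix (Fin m) (Fin n) F} (hM : M ∈ subcode C X) :
    M.rank ≤ finrank F X := by
  rw [Matrix.rank_eq_finrank_span_row]
  exact Submodule.finrank_mono hM.2

theorem rank_le_maxRank {A : Submodule F (Matrix (Fin m) (Fin n) F)} {M : Matrix (Fin m) (Fin n) F}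
    (hM : M ∈ A) : M.rank ≤ maxRank A :=
  le_csSup ⟨n, by rintro _ ⟨N, -, rfl⟩; exact N.rank_le_width⟩ ⟨M, hM, rfl⟩

theorem exists_rank_eq_finrank {X : Submodule F (Fin n → F)} (hX : finrank F X ≤ m) :
    ∃ M ∈ subcode (⊤ : Submodule F (Matrix (Fin m) (Fin n) F)) X, M.rank = finrank F X := by
  let b := finBasis F X
  let M : Matrix (Fin m) (Fin n) F :=
    fun i => if h : (i : ℕ) < finrank F X then (b ⟨i, h⟩ : Fin n → F) else 0
  have hM : M ∈ subcode (⊤ : Submodule F (Matrix (Fin m) (Fin n) F)) X := by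
    refine mem_subcode.2 ⟨trivial, fun i => ?_⟩
    by_cases h : (i : ℕ) < finrank F X
    · simp only [M, dif_pos h]
      exact (b _).2
    · simp only [M, dif_neg h]
      exact X.zero_mem
  refine ⟨M, hM, le_antisymm (rank_le_finrank_of_mem_subcode hM) ?_⟩
  rw [Matrix.rank_eq_finrank_span_row]
  have hb : LinearIndependent F fun i => (b i : Fin n → F) :=
    b.linearIndependent.map' X.subtype X.ker_subtype
  have h1 := finrank_span_eq_card hb
  rw [Fintype.card_fin] at h1
  conv_lhs => rw [← h1]
  refine Submodule.finrank_mono (Submodule.span_mono ?_)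
  rintro _ ⟨i, rfl⟩
  exact ⟨⟨i, i.2.trans_le hX⟩, by simp [M, Matrix.row]⟩

theorem isOptimalAnticode_subcode_top {X : Submodule F (Fin n → F)} (hX : finrank F X ≤ m) :
    IsOptimalAnticode (subcode (⊤ : Submodule F (Matrix (Fin m) (Fin n) F)) X) := by
  have h : maxRank (subcode (⊤ : Submodule F (Matrix (Fin m) (Fin n) F)) X) = finrank F X := by
    obtain ⟨M, hM, hrank⟩ := exists_rank_eq_finrank hX
    refine le_antisymm (csSup_le ⟨_, M, hM, rfl⟩ ?_) (hrank ▸ rank_le_maxRank hM)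
    rintro _ ⟨N, hN, rfl⟩
    exact rank_le_finrank_of_mem_subcode hN
  rw [IsOptimalAnticode, finrank_subcode_top, h]

theorem maxRank_transposeCode (A : Submodule F (Matrix (Fin m) (Fin n) F)) :
    maxRank (transposeCode A) = maxRank A := by
  unfold maxRank
  congr 1
  ext k
  constructor
  · rintro ⟨M, hM, rfl⟩
    exact ⟨_, mem_transposeCode.1 hM, M.rank_transpose⟩
  · rintro ⟨M, hM, rfl⟩
    exact ⟨_, mem_transposeCode.2 (by simpa using hM), M.rank_transpose⟩

theorem IsOptimalAnticode.transposeCode {A : Submodule F (Matrix (Fin m) (Fin m) F)}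
    (hA : IsOptimalAnticode A) : IsOptimalAnticode (transposeCode A) := by
  rw [IsOptimalAnticode, finrank_transposeCode, maxRank_transposeCode]
  exact hA

/-- An optimal anticode of square matrices is contained in a space of matrices with row space, or
with column space, in a fixed subspace of the right dimension. -/
theorem IsOptimalAnticode.exists_le_subcode_or {A : Submodule F (Matrix (Fin m) (Fin m) F)}
    (hA : IsOptimalAnticode A) :
    ∃ X : Submodule F (Fin m → F), m * finrank F X ≤ finrank F A ∧
      (A ≤ subcode ⊤ X ∨ RankMetric.transposeCode A ≤ subcode ⊤ X) := by
  obtain ⟨X, hX, h⟩ := RankMetric.exists_le_subcode_or (fun M hM => rank_le_maxRank hM) hA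
  exact ⟨X, hA ▸ Nat.mul_le_mul_left m hX, h⟩

/-! ### The demi-polymatroid of a square code -/

theorem rhoCode_dotPerp (C : Submodule F (Matrix (Fin m) (Fin n) F)) (X : Submodule F (Fin n → F)) :
    rhoCode C (dotPerp X) = finrank F C - finrank F (subcode C X) := by
  rw [rhoCode, dotPerp_dotPerp]

theorem rhoCode_top (C : Submodule F (Matrix (Fin m) (Fin n) F)) :
    rhoCode C ⊤ = finrank F C := by
  rw [rhoCode, dotPerp_top, subcode_bot_right, finrank_bot, Nat.cast_zero, sub_zero]

theorem conullity_eq (ρ : Submodule F (Fin n → F) → ℤ) (X : Submodule F (Fin n → F)) :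
    conullity m ρ X = ρ ⊤ - ρ (dotPerp X) := by
  rw [conullity, dualRank]
  ring

theorem conullity_rhoCode (C : Submodule F (Matrix (Fin m) (Fin n) F))
    (X : Submodule F (Fin n → F)) : conullity m (rhoCode C) X = finrank F (subcode C X) := by
  rw [conullity_eq, rhoCode_top, rhoCode_dotPerp]
  ring

/-- The larger of the dimensions of `C(X)` and `C^T(X)`. -/
noncomputable def maxSubcodeDim (C : Submodule F (Matrix (Fin m) (Fin m) F))
    (X : Submodule F (Fin m → F)) : ℤ :=
  max (finrank F (subcode C X) : ℤ) (finrank F (subcode (transposeCode C) X))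

section MaxSubcodeDim

variable (C : Submodule F (Matrix (Fin m) (Fin m) F))

theorem maxSubcodeDim_bot : maxSubcodeDim C ⊥ = 0 := by
  rw [maxSubcodeDim, subcode_bot_right, subcode_bot_right, finrank_bot, Nat.cast_zero,
    max_self]

theorem maxSubcodeDim_top : maxSubcodeDim C ⊤ = finrank F C := by
  rw [maxSubcodeDim, subcode_top_right, subcode_top_right, finrank_transposeCode, max_self]

theorem maxSubcodeDim_nonneg (X : Submodule F (Fin m → F)) : 0 ≤ maxSubcodeDim C X :=
  le_max_of_le_left (Nat.cast_nonneg _)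

theorem maxSubcodeDim_mono {X Y : Submodule F (Fin m → F)} (h : X ≤ Y) :
    maxSubcodeDim C X ≤ maxSubcodeDim C Y :=
  max_le_max (by exact_mod_cast Submodule.finrank_mono (subcode_mono C h))
    (by exact_mod_cast Submodule.finrank_mono (subcode_mono (transposeCode C) h))

theorem maxSubcodeDim_add_le {X Y : Submodule F (Fin m → F)} (h : X ≤ Y) :
    maxSubcodeDim C Y + m * finrank F X ≤ maxSubcodeDim C X + m * finrank F Y := by
  have h1 := finrank_subcode_add_le C h
  have h2 := finrank_subcode_add_le (transposeCode C) h
  zify at h1 h2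
  rw [maxSubcodeDim, maxSubcodeDim, max_add, max_add]
  exact max_le_max h1 h2

theorem maxSubcodeDim_le (X : Submodule F (Fin m → F)) :
    maxSubcodeDim C X ≤ m * finrank F X := by
  have h := maxSubcodeDim_add_le C (bot_le : ⊥ ≤ X)
  rw [maxSubcodeDim_bot, finrank_bot] at h
  simpa using h

/-- Transposition commutes with duality and preserves dimension, so the MacWilliams relations for
`C` and `C^T` shift both terms of the maximum equally. -/
theorem maxSubcodeDim_traceDual (X : Submodule F (Fin m → F)) :
    maxSubcodeDim (traceDual C) X =
      m * finrank F X - finrank F C + maxSubcodeDim C (dotPerp X) := by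
  have h1 := finrank_subcode_traceDual_add C X
  have h2 := finrank_subcode_traceDual_add (transposeCode C) X
  rw [finrank_transposeCode] at h2
  zify at h1 h2
  rw [maxSubcodeDim, maxSubcodeDim, transposeCode_traceDual]
  omega

theorem min_rhoCode_eq (X : Submodule F (Fin m → F)) :
    min (rhoCode C X) (rhoCode (transposeCode C) X) =
      finrank F C - maxSubcodeDim C (dotPerp X) := by
  rw [rhoCode, rhoCode, finrank_transposeCode, maxSubcodeDim]
  omega

end MaxSubcodeDim

theorem conullity_min_rhoCode {C : Submodule F (Matrix (Fin m) (Fin m) F)}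
    {ρ : Submodule F (Fin m → F) → ℤ}
    (hρ : ∀ X, ρ X = min (rhoCode C X) (rhoCode (transposeCode C) X)) (X : Submodule F (Fin m → F)) :
    conullity m ρ X = maxSubcodeDim C X := by
  rw [conullity_eq, hρ, hρ, min_rhoCode_eq, min_rhoCode_eq, dotPerp_dotPerp, dotPerp_top,
    maxSubcodeDim_bot]
  ring

theorem isDemiPolymatroid_min_rhoCode {C : Submodule F (Matrix (Fin m) (Fin m) F)}
    {ρ : Submodule F (Fin m → F) → ℤ}
    (hρ : ∀ X, ρ X = min (rhoCode C X) (rhoCode (transposeCode C) X)) :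
    IsDemiPolymatroid m ρ := by
  have hdual : ∀ X, dualRank m ρ X = m * finrank F X - maxSubcodeDim C X := fun X => by
    rw [← conullity_min_rhoCode hρ X, conullity]
    ring
  have hρ' : ∀ X, ρ X = finrank F C - maxSubcodeDim C (dotPerp X) := fun X => by
    rw [hρ, min_rhoCode_eq]
  constructor
  · intro X
    rw [hρ']
    have h1 := maxSubcodeDim_mono C (le_top : dotPerp X ≤ ⊤)
    have h2 := maxSubcodeDim_add_le C (le_top : dotPerp X ≤ ⊤)
    have h3 := finrank_add_finrank_dotPerp X
    rw [maxSubcodeDim_top] at h1 h2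
    rw [finrank_top, finrank_fin_fun] at h2
    have h4 : (m : ℤ) * finrank F X + m * finrank F (dotPerp X) = m * m := by
      rw [← mul_add]
      exact_mod_cast congrArg (m * ·) h3
    constructor <;> linarith
  · intro X Y h
    rw [hρ', hρ']
    have := maxSubcodeDim_mono C (dotPerp_anti h)
    linarith
  · intro X
    rw [hdual]
    have h1 := maxSubcodeDim_le C X
    have h2 := maxSubcodeDim_nonneg C X
    constructor <;> linarith
  · intro X Y h
    rw [hdual, hdual]
    have := maxSubcodeDim_add_le C h
    linarith

theorem genWeight_min_rhoCode {C : Submodule F (Matrix (Fin m) (Fin m) F)}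
    {ρ : Submodule F (Fin m → F) → ℤ}
    (hρ : ∀ X, ρ X = min (rhoCode C X) (rhoCode (transposeCode C) X)) {r : ℤ} (hr : r ≤ ρ ⊤) :
    genWeight m ρ r =
      min (genWeight m (rhoCode C) r) (genWeight m (rhoCode (transposeCode C)) r) := by
  have hr' : r ≤ finrank F C := by
    rwa [hρ, min_rhoCode_eq, dotPerp_top, maxSubcodeDim_bot, sub_zero] at hr
  -- Nonemptiness matters: the default `sInf ∅ = 0` would spoil the minimum.
  have hne : ∀ D : Submodule F (Matrix (Fin m) (Fin m) F), finrank F D = finrank F C →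
      {d : ℕ | ∃ X : Submodule F (Fin m → F),
        r ≤ conullity m (rhoCode D) X ∧ finrank F X = d}.Nonempty := fun D hD =>
    ⟨_, ⊤, by rwa [conullity_rhoCode, subcode_top_right, hD], rfl⟩
  have h1 : {d : ℕ | ∃ X : Submodule F (Fin m → F), r ≤ conullity m ρ X ∧ finrank F X = d} =
      {d : ℕ | ∃ X : Submodule F (Fin m → F), r ≤ conullity m (rhoCode C) X ∧ finrank F X = d} ∪
      {d : ℕ | ∃ X : Submodule F (Fin m → F),
        r ≤ conullity m (rhoCode (transposeCode C)) X ∧ finrank F X = d} := by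
    ext d
    simp only [Set.mem_union, Set.mem_ofPred_eq, conullity_min_rhoCode hρ, conullity_rhoCode,
      maxSubcodeDim, le_max_iff, or_and_right, exists_or]
  unfold genWeight
  rw [h1]
  exact csInf_union (OrderBot.bddBelow _) (hne _ rfl) (OrderBot.bddBelow _)
    (hne _ (finrank_transposeCode C))

/-! ### Anticode weights -/

theorem finrank_inf_le_maxSubcodeDim (C : Submodule F (Matrix (Fin m) (Fin m) F))
    {A : Submodule F (Matrix (Fin m) (Fin m) F)} {X : Submodule F (Fin m → F)}
    (h : A ≤ subcode ⊤ X ∨ transposeCode A ≤ subcode ⊤ X) :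
    (finrank F (A ⊓ C : Submodule F (Matrix (Fin m) (Fin m) F)) : ℤ) ≤ maxSubcodeDim C X := by
  rcases h with h | h
  · refine le_max_of_le_left (Nat.cast_le.2 (Submodule.finrank_mono fun M hM => ?_))
    exact ⟨hM.2, (h hM.1).2⟩
  · refine le_max_of_le_right (Nat.cast_le.2 ?_)
    rw [← finrank_transposeCode]
    refine Submodule.finrank_mono fun M hM => ?_
    rw [mem_transposeCode] at hM
    exact ⟨mem_transposeCode.2 hM.2, (h (mem_transposeCode.2 hM.1)).2⟩

/-- Take all matrices with row space in `X`, or their transposes, according to which term attains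
the maximum. -/
theorem exists_isOptimalAnticode (C : Submodule F (Matrix (Fin m) (Fin m) F))
    (X : Submodule F (Fin m → F)) :
    ∃ A : Submodule F (Matrix (Fin m) (Fin m) F), IsOptimalAnticode A ∧
      finrank F A = m * finrank F X ∧
      maxSubcodeDim C X ≤ finrank F (A ⊓ C : Submodule F (Matrix (Fin m) (Fin m) F)) := by
  have hX : finrank F X ≤ m := by simpa using Submodule.finrank_le X
  have hopt := isOptimalAnticode_subcode_top hX
  rcases le_total (finrank F (subcode C X)) (finrank F (subcode (transposeCode C) X)) with h | h
  · refine ⟨transposeCode (subcode ⊤ X), hopt.transposeCode, ?_, ?_⟩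
    · rw [finrank_transposeCode, finrank_subcode_top]
    · rw [maxSubcodeDim, max_eq_right (Nat.cast_le.2 h), Nat.cast_le, ← finrank_transposeCode]
      refine Submodule.finrank_mono fun M hM => ?_
      rw [mem_transposeCode] at hM
      refine ⟨mem_transposeCode.2 ⟨trivial, hM.2⟩, ?_⟩
      simpa [mem_transposeCode] using hM.1
  · refine ⟨subcode ⊤ X, hopt, finrank_subcode_top X, ?_⟩
    rw [maxSubcodeDim, max_eq_left (Nat.cast_le.2 h), Nat.cast_le]
    exact Submodule.finrank_mono fun M hM => ⟨⟨trivial, hM.2⟩, hM.1⟩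

/-- The anticode weight `a_r` is the generalized weight `min {dim X : max (dim C(X), dim C^T(X)) ≥ r}`. -/
theorem anticodeWeight_eq_sInf (hm : 0 < m) {C : Submodule F (Matrix (Fin m) (Fin m) F)} {r : ℤ}
    (hr : r ≤ finrank F C) :
    anticodeWeight C r =
      (sInf {k : ℕ | ∃ X : Submodule F (Fin m → F), finrank F X = k ∧ r ≤ maxSubcodeDim C X} : ℕ) := by
  set S := {k : ℕ | ∃ X : Submodule F (Fin m → F), finrank F X = k ∧ r ≤ maxSubcodeDim C X} with hS
  have hSne : S.Nonempty := ⟨_, ⊤, rfl, by rwa [maxSubcodeDim_top]⟩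
  set T := {d : ℕ | ∃ A : Submodule F (Matrix (Fin m) (Fin m) F), IsOptimalAnticode A ∧
    r ≤ finrank F (A ⊓ C : Submodule F (Matrix (Fin m) (Fin m) F)) ∧ finrank F A = d} with hT
  have hST : ∀ k ∈ S, m * k ∈ T := by
    rintro _ ⟨X, rfl, hX⟩
    obtain ⟨A, hA, hAd, hAC⟩ := exists_isOptimalAnticode C X
    exact ⟨A, hA, hX.trans hAC, hAd⟩
  have hTS : ∀ d ∈ T, ∃ k ∈ S, m * k ≤ d := by
    rintro _ ⟨A, hA, hr, rfl⟩
    obtain ⟨X, hX, h⟩ := hA.exists_le_subcode_or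
    exact ⟨_, ⟨X, rfl, hr.trans (finrank_inf_le_maxSubcodeDim C h)⟩, hX⟩
  have heq : sInf T = m * sInf S := by
    refine le_antisymm (Nat.sInf_le (hST _ (Nat.sInf_mem hSne))) ?_
    obtain ⟨k, hk, hle⟩ := hTS _ (Nat.sInf_mem ⟨_, hST _ (Nat.sInf_mem hSne)⟩)
    exact (Nat.mul_le_mul_left m (Nat.sInf_le hk)).trans hle
  have hm' : (m : ℚ) ≠ 0 := by exact_mod_cast hm.ne'
  rw [anticodeWeight, ← hT, heq, Nat.cast_mul, mul_div_cancel_left₀ _ hm']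

/-! ### Wei duality -/

/-- `g k` is the maximum of `max (dim C(X), dim C^T(X))` over the `k`-dimensional `X`. -/
def IsDimProfile (C : Submodule F (Matrix (Fin m) (Fin m) F)) (g : ℕ → ℤ) : Prop :=
  ∀ k ≤ m,
    (∃ X : Submodule F (Fin m → F), finrank F X = k ∧ maxSubcodeDim C X = g k) ∧
    ∀ X : Submodule F (Fin m → F), finrank F X = k → maxSubcodeDim C X ≤ g k

theorem exists_isDimProfile (C : Submodule F (Matrix (Fin m) (Fin m) F)) :
    ∃ g, IsDimProfile C g := by
  have h : ∀ k : ℕ, ∃ z : ℤ, k ≤ m →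
      (∃ X : Submodule F (Fin m → F), finrank F X = k ∧ maxSubcodeDim C X = z) ∧
      ∀ X : Submodule F (Fin m → F), finrank F X = k → maxSubcodeDim C X ≤ z := by
    intro k
    by_cases hk : k ≤ m
    · obtain ⟨X₀, hX₀⟩ := exists_finrank_eq (F := F) hk
      obtain ⟨z, ⟨X, hX, rfl⟩, hmax⟩ := Int.exists_greatest_of_bdd
        (P := fun z => ∃ X : Submodule F (Fin m → F), finrank F X = k ∧ maxSubcodeDim C X = z)
        ⟨m * k, by rintro _ ⟨X, rfl, rfl⟩; exact maxSubcodeDim_le C X⟩ ⟨_, X₀, hX₀, rfl⟩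
      exact ⟨_, fun _ => ⟨⟨X, hX, rfl⟩, fun Y hY => hmax _ ⟨Y, hY, rfl⟩⟩⟩
    · exact ⟨0, fun h => absurd h hk⟩
  choose g hg using h
  exact ⟨g, hg⟩

namespace IsDimProfile

variable {C : Submodule F (Matrix (Fin m) (Fin m) F)} {g : ℕ → ℤ}

theorem zero (hg : IsDimProfile C g) : g 0 = 0 := by
  obtain ⟨⟨X, hX, h⟩, -⟩ := hg 0 (Nat.zero_le _)
  rw [← h, Submodule.finrank_eq_zero.1 hX, maxSubcodeDim_bot]

theorem top (hg : IsDimProfile C g) : g m = finrank F C := by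
  obtain ⟨⟨X, hX, h⟩, -⟩ := hg m le_rfl
  rw [← h, Submodule.eq_top_of_finrank_eq (hX.trans (finrank_fin_fun F).symm), maxSubcodeDim_top]

theorem le_succ (hg : IsDimProfile C g) {k : ℕ} (hk : k < m) : g k ≤ g (k + 1) := by
  obtain ⟨⟨X, hX, h⟩, -⟩ := hg k hk.le
  obtain ⟨Y, hXY, hY⟩ := exists_le_finrank_eq_succ (X := X) (by omega)
  rw [← h]
  exact (maxSubcodeDim_mono C hXY).trans ((hg (k + 1) hk).2 Y (by omega))

theorem mono (hg : IsDimProfile C g) {k l : ℕ} (hkl : k ≤ l) (hl : l ≤ m) : g k ≤ g l := by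
  induction l, hkl using Nat.le_induction with
  | base => exact le_rfl
  | succ l _ ih => exact (ih (by omega)).trans (hg.le_succ hl)

theorem traceDual (hg : IsDimProfile C g) :
    IsDimProfile (traceDual C) fun k => m * k - finrank F C + g (m - k) := by
  intro k hk
  obtain ⟨⟨X, hX, h⟩, hmax⟩ := hg (m - k) (Nat.sub_le _ _)
  constructor
  · have h1 := finrank_add_finrank_dotPerp X
    have h2 : finrank F (dotPerp X) = k := by omega
    refine ⟨dotPerp X, h2, ?_⟩
    rw [maxSubcodeDim_traceDual, h2, dotPerp_dotPerp, h]
  · intro Y hY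
    have h1 := finrank_add_finrank_dotPerp Y
    rw [maxSubcodeDim_traceDual, hY]
    have := hmax (dotPerp Y) (by omega)
    linarith

/-- By monotonicity of `g`, the weight is the first dimension at which `g` reaches `r`. -/
theorem anticodeWeight_eq_iff (hg : IsDimProfile C g) {r : ℤ} (hr : r ≤ finrank F C) {k : ℕ}
    (hk : 1 ≤ k) (hkm : k ≤ m) : anticodeWeight C r = k ↔ g (k - 1) < r ∧ r ≤ g k := by
  rw [anticodeWeight_eq_sInf (by omega) hr, Nat.cast_inj]
  set S := {k : ℕ | ∃ X : Submodule F (Fin m → F), finrank F X = k ∧ r ≤ maxSubcodeDim C X}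
  have hSne : S.Nonempty := ⟨_, ⊤, rfl, by rwa [maxSubcodeDim_top]⟩
  have hS : ∀ l ≤ m, l ∈ S ↔ r ≤ g l := by
    intro l hl
    obtain ⟨⟨X, hX, h⟩, hmax⟩ := hg l hl
    refine ⟨?_, fun hr => ⟨X, hX, h ▸ hr⟩⟩
    rintro ⟨Y, hY, hr⟩
    exact hr.trans (hmax Y hY)
  constructor
  · intro h
    refine ⟨?_, (hS k hkm).1 (h ▸ Nat.sInf_mem hSne)⟩
    by_contra! hc
    have := Nat.sInf_le ((hS (k - 1) (by omega)).2 hc)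
    omega
  · rintro ⟨h1, h2⟩
    refine le_antisymm (Nat.sInf_le ((hS k hkm).2 h2)) ?_
    by_contra! hc
    have h3 := (hS _ (by omega)).1 (Nat.sInf_mem hSne)
    exact absurd (h3.trans (hg.mono (Nat.le_sub_one_of_lt hc) (by omega))) (not_le.2 h1)

theorem exists_anticodeWeight_eq (hg : IsDimProfile C g) {r : ℤ} (hr1 : 1 ≤ r)
    (hr : r ≤ finrank F C) : ∃ k : ℕ, 1 ≤ k ∧ k ≤ m ∧ anticodeWeight C r = k := by
  classical
  have hex : ∃ k, r ≤ g k := ⟨m, by rwa [hg.top]⟩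
  have h0 : Nat.find hex ≠ 0 := fun h => by
    have := Nat.find_spec hex
    rw [h, hg.zero] at this
    omega
  have hm : Nat.find hex ≤ m := Nat.find_min' hex (by rwa [hg.top])
  refine ⟨_, Nat.one_le_iff_ne_zero.2 h0, hm, ?_⟩
  rw [hg.anticodeWeight_eq_iff hr (Nat.one_le_iff_ne_zero.2 h0) hm]
  exact ⟨not_le.1 (Nat.find_min hex (by omega)), Nat.find_spec hex⟩

theorem anticodeWeight_traceDual_eq_iff (hg : IsDimProfile C g) {r : ℤ}
    (hr : r ≤ finrank F (RankMetric.traceDual C)) {k : ℕ} (hk : 1 ≤ k) (hkm : k ≤ m) :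
    anticodeWeight (RankMetric.traceDual C) r = k ↔
      g (m + 1 - k) - m < r + finrank F C - m * k ∧ r + finrank F C - m * k ≤ g (m - k) := by
  rw [hg.traceDual.anticodeWeight_eq_iff hr hk hkm, show m - (k - 1) = m + 1 - k by omega]
  push_cast [hk]
  constructor <;> rintro ⟨h1, h2⟩ <;> constructor <;> linarith

/-- Weights of `C` and of its dual in matching residue classes never add up to `m + 1`. -/
theorem anticodeWeight_traceDual_ne (hg : IsDimProfile C g) {r t : ℤ} (hr1 : 1 ≤ r)
    (hr : r ≤ finrank F (RankMetric.traceDual C)) (ht : t ≤ finrank F C)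
    (hrt : t ≡ r + finrank F C [ZMOD m]) :
    anticodeWeight (RankMetric.traceDual C) r ≠ m + 1 - anticodeWeight C t := by
  intro h
  obtain ⟨k, hk, hkm, hrk⟩ := hg.traceDual.exists_anticodeWeight_eq hr1 hr
  have htk : anticodeWeight C t = (m + 1 - k : ℕ) := by
    push_cast [(by omega : k ≤ m + 1)]
    rw [← hrk, h]
    ring
  rw [hg.anticodeWeight_eq_iff ht (by omega) (by omega), show m + 1 - k - 1 = m - k by omega] at htk
  rw [hg.anticodeWeight_traceDual_eq_iff hr hk hkm] at hrk
  -- The two numbers lie in adjacent intervals of total length `m`, so their difference is strictly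
  -- between 0 and `m`.
  have hdvd : (m : ℤ) ∣ t - (r + finrank F C - m * k) := by
    rw [← sub_add]
    exact dvd_add hrt.symm.dvd (dvd_mul_right (m : ℤ) k)
  have h0 := Int.eq_zero_of_dvd_of_nonneg_of_lt (by linarith) (by linarith) hdvd
  linarith

end IsDimProfile

/-- Wei duality for the anticode weights of a square code and its trace dual. -/
theorem weightSet_traceDual (hm : 0 < m) (C : Submodule F (Matrix (Fin m) (Fin m) F)) {s t : ℤ}
    (hst : t ≡ s + finrank F C [ZMOD m]) :
    weightSet (traceDual C) s =
      {a : ℚ | ∃ k : ℕ, 1 ≤ k ∧ k ≤ m ∧ a = k} \ weightSetBar C t := by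
  obtain ⟨g, hg⟩ := exists_isDimProfile C
  ext a
  constructor
  · rintro ⟨r, hr1, hr, hrs, rfl⟩
    refine ⟨hg.traceDual.exists_anticodeWeight_eq hr1 hr, ?_⟩
    rintro ⟨u, -, hu, hut, h⟩
    exact hg.anticodeWeight_traceDual_ne hr1 hr hu
      ((hut.trans hst).trans (hrs.symm.add_right _)) h
  · rintro ⟨⟨k, hk, hkm, rfl⟩, hbar⟩
    -- `u` represents the class of `t` in the window of length `m` ending at `g (m + 1 - k)`. Its
    -- upper part, beyond `g (m - k)`, would put `k` in the excluded set.
    obtain ⟨u, hut, hu1, hu2⟩ : ∃ u : ℤ, u ≡ t [ZMOD m] ∧ g (m + 1 - k) - m < u ∧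
        u ≤ g (m + 1 - k) := by
      have h1 := Int.emod_nonneg (g (m + 1 - k) - t) (by omega : (m : ℤ) ≠ 0)
      have h2 := Int.emod_lt_of_pos (g (m + 1 - k) - t) (by omega : (0 : ℤ) < m)
      refine ⟨g (m + 1 - k) - (g (m + 1 - k) - t) % m, ?_, by linarith, by linarith⟩
      have := (Int.mod_modEq (g (m + 1 - k) - t) m).sub_left (g (m + 1 - k))
      simpa using this
    have hgk := hg.mono (by omega : m + 1 - k ≤ m) le_rfl
    rw [hg.top] at hgk
    have hu : u ≤ g (m - k) := by
      by_contra! hc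
      have h0 := hg.mono (Nat.zero_le (m - k)) (Nat.sub_le _ _)
      rw [hg.zero] at h0
      have huK : u ≤ finrank F C := hu2.trans hgk
      have h1 : anticodeWeight C u = (m + 1 - k : ℕ) := by
        rw [hg.anticodeWeight_eq_iff huK (by omega) (by omega),
          show m + 1 - k - 1 = m - k by omega]
        exact ⟨hc, hu2⟩
      refine hbar ⟨u, by omega, huK, hut, ?_⟩
      rw [h1]
      push_cast [(by omega : k ≤ m + 1)]
      ring
    -- Monotonicity of the dual profile, from 0 up to dim C^⊥, gives the bounds on the index `u - K
    -- + m k`.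
    have hlow := hg.traceDual.mono (Nat.zero_le (k - 1)) (by omega)
    have hhigh := hg.traceDual.mono hkm le_rfl
    rw [hg.traceDual.zero] at hlow
    rw [hg.traceDual.top] at hhigh
    rw [show m - (k - 1) = m + 1 - k by omega] at hlow
    push_cast [hk] at hlow
    have hr : u - finrank F C + m * k ≤ finrank F (traceDual C) := by linarith
    refine ⟨u - finrank F C + m * k, by linarith, hr, ?_, ?_⟩
    · have h1 := (hut.trans hst).sub_right (finrank F C : ℤ)
      rw [add_sub_cancel_right] at h1
      simpa using h1.add (Int.modEq_zero_iff_dvd.2 (dvd_mul_right (m : ℤ) k))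
    · symm
      rw [hg.anticodeWeight_traceDual_eq_iff hr hk hkm]
      constructor <;> linarith

end RankMetric

theorem proposition5p8 {F : Type*} [Field F] [Finite F] {m : ℕ} (hm : 0 < m)
    (C : Submodule F (Matrix (Fin m) (Fin m) F))
    (ρ : Submodule F (Fin m → F) → ℤ)
    (hρ : ∀ X, ρ X = min (rhoCode C X) (rhoCode (transposeCode C) X)) :
    -- `(E, ρ)` is a demi-polymatroid, with the stated conullity function
    IsDemiPolymatroid m ρ ∧
    (∀ X, conullity m ρ X =
      max (Module.finrank F (subcode C X) : ℤ) (Module.finrank F (subcode (transposeCode C) X))) ∧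
    -- its generalized weights
    (∀ r : ℤ, 1 ≤ r → r ≤ ρ ⊤ →
      genWeight m ρ r =
        min (genWeight m (rhoCode C) r) (genWeight m (rhoCode (transposeCode C)) r)) ∧
    -- Wei duality for the anticode weights, first as non-coincidence of weights
    (∀ p i j : ℤ, 1 ≤ p + i * m → p + i * m ≤ (m : ℤ) * m - Module.finrank F C →
      1 ≤ p + Module.finrank F C + j * m → p + Module.finrank F C + j * m ≤ Module.finrank F C →
      anticodeWeight (traceDual C) (p + i * m) ≠
        m + 1 - anticodeWeight C (p + Module.finrank F C + j * m)) ∧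
    -- and then as a partition of `{1, ..., m}` for each residue class modulo `m`
    (∀ s : ℤ, 0 ≤ s → s < m →
      weightSet (traceDual C) s =
        {a : ℚ | ∃ k : ℕ, 1 ≤ k ∧ k ≤ m ∧ a = k} \
          weightSetBar C ((s + Module.finrank F C) % (m : ℤ))) := by
  refine ⟨isDemiPolymatroid_min_rhoCode hρ, conullity_min_rhoCode hρ,
    fun r _ hr => genWeight_min_rhoCode hρ hr, ?_, fun s _ _ => weightSet_traceDual hm C ?_⟩
  · intro p i j h1 h2 _ h4
    obtain ⟨g, hg⟩ := exists_isDimProfile C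
    have h5 := finrank_add_finrank_traceDual C
    zify at h5
    refine hg.anticodeWeight_traceDual_ne h1 (by linarith) h4 ?_
    refine Int.modEq_iff_dvd.2 ⟨i - j, ?_⟩
    ring
  · exact Int.mod_modEq _ _
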